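/- Setting. Let $n\ge 2$, let $G$ be a finite simple graph and let $C_n=\langle\omega:\omega^n=1\rangle$ act faithfully on $G$ by automorphisms, such that every vertex fixed by some $\gamma\ne1$ is invariant (fixed by all of $C_n$) and no two invariant vertices are adjacent; $G$ is then called $C_n$-symmetric. A $C_n$-symmetric framework $(G,p)$ consists of such a graph and a map $p:V(G)\to\mathbb R^2$ with $p(a)\ne p(b)$ for all $ab\in E(G)$ and $p(\omega^k a)=\tau(\omega^k)p(a)$ for all $a\in V(G)$ and all $k$, where $$\tau(\omega^k)=\begin{pmatrix}\cos\frac{2\pi k}{n}&\sin\frac{2\pi k}{n}\\-\sin\frac{2\pi k}{n}&\cos\frac{2\pi k}{n}\end{pmatrix}.$$ Fix a non-invariant vertex $v_0$ with $p(v_0)\neq(0,0)$ lying on the $x$-axis. Let $\mathcal V_n(G,p)\subset(\mathbb C^2)^{V(G)}$ be the set of all $q=(x_a,y_a)_{a\in V(G)}$ with $y_{v_0}=0$, with $q(\omega a)=\tau(\omega)q(a)$ for all $a\in V(G)$, and with $(x_a-x_b)^2+(y_a-y_b)^2=\|p(a)-p(b)\|^2$ for all $ab\in E(G)$. A $C_n$-symmetric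 motion of $(G,p)$ is an irreducible (closed, affine) algebraic curve $C\subseteq\mathcal V_n(G,p)$. A NAC-colouring of $G$ is a surjective map $\delta:E(G)\to\{\text{red},\text{blue}\}$ such that every cycle of $G$ either is monochromatic or contains at least two red and at least two blue edges. Put $W_{a,b}=(x_a-x_b)+i(y_a-y_b)\in\mathbb C(C)$. A NAC-colouring $\delta$ is active for $C$ if there are a valuation $\nu$ of the function field $\mathbb C(C)$ that is trivial on $\mathbb C$ and a threshold $\alpha$ such that, for every edge $ab$, $\delta(ab)$ is red if $\nu(W_{a,b})>\alpha$ and blue if $\nu(W_{a,b})\le\alpha$. Lemma. Let $C$ be a $C_n$-symmetric motion of $(G,p)$. Let $u,v$ be vertices of $G$ such that $uv\notin E(G)$ and $q(u)\neq q(v)$ for all $q\in C$. Suppose that there is a path $P$ in $G$ from $u$ to $v$ that is monochromatic for every active NAC-colouring of $C$. Then the squared distance $(x_u-x_v)^2+(y_u-y_v)^2$ takes the same value at all points $q\in C$. Consequently, if $p$ is a point of $C$, then $C$ is a $C_n$-symmetric motion of $(G',p)$, where $G'=(V(G),E(G)\cup\{\gamma u\,\gamma v:\gamma\in C_n\})$;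 in particular, $(G',p)$ is a $C_n$-symmetric framework. -/

import Mathlib

namespace RotSym

open MvPolynomial

universe u

variable {V : Type u}

/-! Graphs with an action of the cyclic group `C_n` -/

/-- The cyclic group of order `n`, written multiplicatively. -/
abbrev Cyc (n : ℕ) : Type := Multiplicative (ZMod n)

/-- The generator `ω` of the cyclic group. -/
def omega (n : ℕ) : Cyc n := Multiplicative.ofAdd 1

/-- `G` is a `C_n`-symmetric graph: `C_n` acts faithfully on `V` by automorphisms of `G`, every
partially invariant vertex is invariant, and the invariant vertices are independent. -/
structure IsSymmetricGraph (n : ℕ) (θ : Cyc n →* Equiv.Perm V) (G : SimpleGraph V) : Prop where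
  injective : Function.Injective θ
  adj_iff : ∀ (γ : Cyc n) (u v : V), G.Adj (θ γ u) (θ γ v) ↔ G.Adj u v
  invariant_of_partially : ∀ v : V, (∃ γ : Cyc n, γ ≠ 1 ∧ θ γ v = v) → ∀ γ : Cyc n, θ γ v = v
  independent : ∀ u v : V, (∀ γ : Cyc n, θ γ u = u) → (∀ γ : Cyc n, θ γ v = v) → ¬ G.Adj u v

/-- The rotation of the plane by the angle `a`, oriented clockwise. -/
noncomputable def rotate (a : ℝ) (x : EuclideanSpace ℝ (Fin 2)) : EuclideanSpace ℝ (Fin 2) :=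
  !₂[Real.cos a * x 0 + Real.sin a * x 1, -Real.sin a * x 0 + Real.cos a * x 1]

/-- `(G, p)` is a `C_n`-symmetric framework: adjacent vertices are placed at different points, and
`ω ^ k` acts on the placement as the rotation by `2kπ/n`. -/
structure IsSymmetricFramework (n : ℕ) (θ : Cyc n →* Equiv.Perm V) (G : SimpleGraph V)
    (p : V → EuclideanSpace ℝ (Fin 2)) : Prop where
  graph : IsSymmetricGraph n θ G
  placement : ∀ u v : V, G.Adj u v → p u ≠ p v
  symmetric : ∀ (k : ℕ) (v : V), p (θ (omega n ^ k) v) = rotate (2 * k * Real.pi / n) (p v)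

/-! Complex configurations. A point `q` of `(ℂ²)^V` has the coordinates `x_v = q (v, 0)` and
`y_v = q (v, 1)`. -/

/-- The point `q(v)` of `ℂ²`. -/
def point (q : V × Fin 2 → ℂ) (v : V) : ℂ × ℂ := (q (v, 0), q (v, 1))

/-- The squared distance `(x_u - x_v)² + (y_u - y_v)²` of the points `q(u)` and `q(v)`. -/
def sqDist (q : V × Fin 2 → ℂ) (u v : V) : ℂ :=
  (q (u, 0) - q (v, 0)) ^ 2 + (q (u, 1) - q (v, 1)) ^ 2

/-- A real placement, seen as a point of `(ℂ²)^V`. -/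
def complexify (p : V → EuclideanSpace ℝ (Fin 2)) : V × Fin 2 → ℂ :=
  fun i => ((p i.1 i.2 : ℝ) : ℂ)

/-- The algebraic set `𝒱_n(G, p)` in `(ℂ²)^V`, with the base vertex `v₀`. -/
def configSet (n : ℕ) (θ : Cyc n →* Equiv.Perm V) (G : SimpleGraph V)
    (p : V → EuclideanSpace ℝ (Fin 2)) (v₀ : V) : Set (V × Fin 2 → ℂ) :=
  {q | q (v₀, 1) = 0 ∧
    (∀ v : V, q (θ (omega n) v, 0) =
      (Real.cos (2 * Real.pi / n) : ℂ) * q (v, 0) + (Real.sin (2 * Real.pi / n) : ℂ) * q (v, 1)) ∧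
    (∀ v : V, q (θ (omega n) v, 1) =
      -(Real.sin (2 * Real.pi / n) : ℂ) * q (v, 0) + (Real.cos (2 * Real.pi / n) : ℂ) * q (v, 1)) ∧
    (∀ u v : V, G.Adj u v → sqDist q u v = ((‖p u - p v‖ ^ 2 : ℝ) : ℂ))}

/-- The coordinate ring `ℂ[C]`. -/
abbrev CoordRing (C : Set (V × Fin 2 → ℂ)) : Type u :=
  MvPolynomial (V × Fin 2) ℂ ⧸ vanishingIdeal ℂ C

/-- The function field `ℂ(C)` (a field when `C` is irreducible). -/
abbrev FunctionField (C : Set (V × Fin 2 → ℂ)) : Type u := FractionRing (CoordRing C)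

/-- `C` is an irreducible (affine) algebraic curve. -/
structure IsIrreducibleCurve (C : Set (V × Fin 2 → ℂ)) : Prop where
  algebraic : zeroLocus ℂ (vanishingIdeal ℂ C) = C
  irreducible : (vanishingIdeal ℂ C).IsPrime
  dim_eq_one : ringKrullDim (CoordRing C) = 1

/-- `C` is a `C_n`-symmetric motion of the `C_n`-symmetric framework `(G, p)`, with respect to the
base vertex `v₀`, a non-invariant vertex which `p` places on the `x`-axis and not at the origin. -/
structure IsSymmetricMotion (n : ℕ) (θ : Cyc n →* Equiv.Perm V) (G : SimpleGraph V)
    (p : V → EuclideanSpace ℝ (Fin 2)) (v₀ : V) (C : Set (V × Fin 2 → ℂ)) : Prop where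
  framework : IsSymmetricFramework n θ G p
  base_not_invariant : ∃ γ : Cyc n, θ γ v₀ ≠ v₀
  base_ne_zero : p v₀ ≠ 0
  base_on_axis : p v₀ 1 = 0
  curve : IsIrreducibleCurve C
  subset : C ⊆ configSet n θ G p v₀

/-! NAC-colourings -/

/-- The two colours. -/
inductive Colour : Type
  | red
  | blue

/-- NAC-colourings: both colours occur, and every cycle either is monochromatic or has at least two
red and at least two blue edges. -/
structure IsNAC (G : SimpleGraph V) (δ : G.edgeSet → Colour) : Prop where
  surjective : Function.Surjective δ
  cycle : ∀ (v : V) (c : G.Walk v v), c.IsCycle →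
    (∀ e f : G.edgeSet, (e : Sym2 V) ∈ c.edges → (f : Sym2 V) ∈ c.edges → δ e = δ f) ∨
    (∀ k : Colour, ∃ e f : G.edgeSet, e ≠ f ∧ (e : Sym2 V) ∈ c.edges ∧ (f : Sym2 V) ∈ c.edges ∧
      δ e = k ∧ δ f = k)

/-- The function `W_{u,v} = (x_u - x_v) + i (y_u - y_v)` in `ℂ(C)`. -/
noncomputable def Wfun (C : Set (V × Fin 2 → ℂ)) (u v : V) : FunctionField C :=
  algebraMap (CoordRing C) (FunctionField C)
    (Ideal.Quotient.mk (vanishingIdeal ℂ C)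
      ((X (u, 0) - X (v, 0)) + MvPolynomial.C Complex.I * (X (u, 1) - X (v, 1))))

/-- An active NAC-colouring of `C`: there are a valuation of `ℂ(C)`, trivial on `ℂ`, and a threshold
such that an edge `uv` is red exactly if the valuation of `W_{u,v}` exceeds the threshold.
Valuations are written multiplicatively here, which reverses the order. -/
def IsActiveNAC (G : SimpleGraph V) (C : Set (V × Fin 2 → ℂ)) (δ : G.edgeSet → Colour) : Prop :=
  IsNAC G δ ∧
  ∃ (Γ₀ : Type u) (_ : LinearOrderedCommGroupWithZero Γ₀) (ν : Valuation (FunctionField C) Γ₀)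
    (α : Γ₀),
    (∀ c : ℂ, c ≠ 0 → ν (algebraMap ℂ (FunctionField C) c) = 1) ∧
    ∀ (u v : V) (h : G.Adj u v),
      δ ⟨s(u, v), G.mem_edgeSet.mpr h⟩ = Colour.red ↔ ν (Wfun C u v) < α

/-- All edges of the walk `P` have the same colour. -/
def IsMonochromatic {G : SimpleGraph V} (δ : G.edgeSet → Colour) {u v : V} (P : G.Walk u v) : Prop :=
  ∀ e f : G.edgeSet, (e : Sym2 V) ∈ P.edges → (f : Sym2 V) ∈ P.edges → δ e = δ f

/-- The graph obtained from `G` by adding the edges `γu γv` for all `γ` in `C_n`. -/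
def addOrbit (n : ℕ) (θ : Cyc n →* Equiv.Perm V) (G : SimpleGraph V) (u v : V) : SimpleGraph V :=
  G ⊔ SimpleGraph.fromEdgeSet {e | ∃ γ : Cyc n, e = s(θ γ u, θ γ v)}

end RotSym

namespace RotSym

open MvPolynomial

/-! ### Valuations of differences along walks and cycles. -/

section Walks

variable {V : Type*} {G : SimpleGraph V} {K : Type*}

/-! Put w = x + iy and z = x - iy, so that squared distance is (w_a - w_b)(z_a - z_b). On an edge
this is a nonzero constant, so a valuation trivial on ℂ takes inverse values on the two factors.
Every threshold on the w-values that yields both colours is then an active NAC-colouring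
(`isNAC_of_valuation`). If two edges of P had different w-values, the larger one as threshold would
split P. So all w-values on P equal some t and all z-values equal t⁻¹; the ultrametric inequality
bounds the squared distance of u and v by t · t⁻¹ = 1. It thus lies in every valuation ring of ℂ(C)
over ℂ, so it is integral over ℂ, hence constant. The new edges are handled by symmetry: rotations
preserve squared distance, so the whole orbit of uv keeps one constant length. -/

lemma sum_darts_sub [AddCommGroup K] (f : V → K) {a b : V} (P : G.Walk a b) :
    (P.darts.map fun d => f d.fst - f d.snd).sum = f a - f b := by
  induction P with
  | nil => simp
  | cons h P ih => simp [ih]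

variable [Field K] {Γ₀ : Type*} [LinearOrderedCommGroupWithZero Γ₀] (ν : Valuation K Γ₀)

lemma valuation_sub_le_of_walk (f : V → K) {a b : V} (P : G.Walk a b) (t : Γ₀)
    (h : ∀ d ∈ P.darts, ν (f d.fst - f d.snd) ≤ t) : ν (f a - f b) ≤ t := by
  induction P with
  | nil => simp
  | @cons x y z e P ih =>
    simp only [SimpleGraph.Walk.darts_cons, List.mem_cons, forall_eq_or_imp] at h
    have hsum := ν.map_add_le h.1 (ih h.2)
    simpa using hsum

/-- Along a closed trail, no difference of a potential strictly dominates all others. -/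
lemma exists_dart_valuation_ge (f : V → K) {a : V} (c : G.Walk a a) (hc : c.IsTrail)
    {d : G.Dart} (hd : d ∈ c.darts) (h0 : f d.fst ≠ f d.snd) :
    ∃ d' ∈ c.darts, d'.edge ≠ d.edge ∧
      ν (f d.fst - f d.snd) ≤ ν (f d'.fst - f d'.snd) := by
  classical
  by_contra! hcon
  have hmap : (c.darts.map SimpleGraph.Dart.edge).Nodup := hc.edges_nodup
  have hnd : c.darts.Nodup := hmap.of_map
  -- A trail repeats no edge, so every dart other than `d` has another edge and, by `hcon`, a
  -- strictly smaller value; their sum cannot cancel the term of `d`.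
  have hinj := List.inj_on_of_nodup_map hmap
  have hs := sum_darts_sub f c
  rw [sub_self, ← List.sum_toFinset _ hnd,
    ← Finset.add_sum_erase _ _ (List.mem_toFinset.2 hd)] at hs
  have hlt : ν (∑ x ∈ c.darts.toFinset.erase d, (f x.fst - f x.snd)) <
      ν (f d.fst - f d.snd) := by
    refine ν.map_sum_lt ((ν.ne_zero_iff).2 (sub_ne_zero.2 h0)) fun x hx => ?_
    obtain ⟨hxd, hx⟩ := Finset.mem_erase.1 hx
    rw [List.mem_toFinset] at hx
    exact hcon x hx fun he => hxd (hinj hx hd he)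
  rw [eq_neg_of_add_eq_zero_left hs, Valuation.map_neg] at hlt
  exact lt_irrefl _ hlt

/-- Differences around a cycle sum to zero, so none strictly dominates. For w, this gives each blue
edge a blue partner of at least its value. For z, whose values are the inverses, it gives each red
edge a red partner. -/
lemma isNAC_of_valuation (w z : V → K)
    (hwz : ∀ a b, G.Adj a b → ν (w a - w b) * ν (z a - z b) = 1) (α : Γ₀)
    (δ : G.edgeSet → Colour) (hs : Function.Surjective δ)
    (hδ : ∀ (a b : V) (h : G.Adj a b),
      δ ⟨s(a, b), G.mem_edgeSet.mpr h⟩ = Colour.red ↔ ν (w a - w b) < α) :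
    IsNAC G δ := by
  refine ⟨hs, fun x c hc => ?_⟩
  by_cases hmono : ∀ e f : G.edgeSet, (e : Sym2 V) ∈ c.edges → (f : Sym2 V) ∈ c.edges → δ e = δ f
  · exact Or.inl hmono
  right
  have hred : ∀ d : G.Dart, δ ⟨d.edge, d.edge_mem⟩ = Colour.red ↔ ν (w d.fst - w d.snd) < α :=
    fun d => hδ d.fst d.snd d.adj
  have hblue : ∀ d : G.Dart, δ ⟨d.edge, d.edge_mem⟩ = Colour.blue ↔
      α ≤ ν (w d.fst - w d.snd) := by
    intro d
    rw [← not_lt, ← hred]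
    cases δ ⟨d.edge, d.edge_mem⟩ <;> simp
  have hdart : ∀ e : G.edgeSet, (e : Sym2 V) ∈ c.edges →
      ∃ d ∈ c.darts, (⟨d.edge, d.edge_mem⟩ : G.edgeSet) = e := by
    rintro ⟨e, he⟩ hec
    obtain ⟨d, hd, hde⟩ := List.mem_map.1 hec
    exact ⟨d, hd, Subtype.ext hde⟩
  have hcol : ∀ k : Colour, ∃ d ∈ c.darts, δ ⟨d.edge, d.edge_mem⟩ = k := by
    push Not at hmono
    obtain ⟨e, f, he, hf, hef⟩ := hmono
    obtain ⟨d, hd, rfl⟩ := hdart e he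
    obtain ⟨d', hd', rfl⟩ := hdart f hf
    intro k
    by_cases hk : δ ⟨d.edge, d.edge_mem⟩ = k
    · exact ⟨d, hd, hk⟩
    · refine ⟨d', hd', ?_⟩
      revert hk hef
      cases δ ⟨d.edge, d.edge_mem⟩ <;> cases δ ⟨d'.edge, d'.edge_mem⟩ <;> cases k <;> simp
  have hpair : ∀ {k : Colour} {d d' : G.Dart}, d ∈ c.darts → d' ∈ c.darts → d'.edge ≠ d.edge →
      δ ⟨d.edge, d.edge_mem⟩ = k → δ ⟨d'.edge, d'.edge_mem⟩ = k →
      ∃ e f : G.edgeSet, e ≠ f ∧ (e : Sym2 V) ∈ c.edges ∧ (f : Sym2 V) ∈ c.edges ∧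
        δ e = k ∧ δ f = k := fun {k d d'} hd hd' hne h h' =>
    ⟨⟨d.edge, d.edge_mem⟩, ⟨d'.edge, d'.edge_mem⟩, fun he => hne (congrArg Subtype.val he).symm,
      List.mem_map_of_mem hd, List.mem_map_of_mem hd', h, h'⟩
  have hw0 : ∀ d : G.Dart, ν (w d.fst - w d.snd) ≠ 0 := fun d =>
    left_ne_zero_of_mul_eq_one (hwz _ _ d.adj)
  have hz0 : ∀ d : G.Dart, ν (z d.fst - z d.snd) ≠ 0 := fun d =>
    right_ne_zero_of_mul_eq_one (hwz _ _ d.adj)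
  have hinv : ∀ d : G.Dart, ν (z d.fst - z d.snd) = (ν (w d.fst - w d.snd))⁻¹ := fun d =>
    eq_inv_of_mul_eq_one_right (hwz _ _ d.adj)
  intro k
  obtain ⟨d, hd, hdk⟩ := hcol k
  cases k with
  | red =>
    obtain ⟨d', hd', hne, hle⟩ := exists_dart_valuation_ge ν z c hc.isTrail hd
      (sub_ne_zero.1 ((ν.ne_zero_iff).1 (hz0 d)))
    refine hpair hd hd' hne hdk ((hred d').2 (lt_of_le_of_lt ?_ ((hred d).1 hdk)))
    rwa [hinv, hinv, inv_le_inv₀ (zero_lt_iff.2 (hw0 d)) (zero_lt_iff.2 (hw0 d'))] at hle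
  | blue =>
    obtain ⟨d', hd', hne, hle⟩ := exists_dart_valuation_ge ν w c hc.isTrail hd
      (sub_ne_zero.1 ((ν.ne_zero_iff).1 (hw0 d)))
    exact hpair hd hd' hne hdk ((hblue d').2 (((hblue d).1 hdk).trans hle))

end Walks

/-! ### Constants and valuation rings. -/

/-- An element of a field over an algebraically closed field that lies in all valuation rings
over the base field is a constant. -/
lemma mem_range_algebraMap_of_forall_valuationSubring {k K : Type*} [Field k] [IsAlgClosed k]
    [Field K] [Algebra k K] (x : K)
    (h : ∀ B : ValuationSubring K, (∀ c : k, algebraMap k K c ∈ B) → x ∈ B) :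
    ∃ c : k, algebraMap k K c = x := by
  have hx : x ∈ (⨅ B : {B : ValuationSubring K //
      Set.range (algebraMap k K) ⊆ B.toSubring}, B.1.toSubring) := by
    rw [Subring.mem_iInf]
    exact fun B => h B.1 fun c => B.2 ⟨c, rfl⟩
  -- The valuation rings containing a subring intersect in its integral closure.
  rw [iInf_valuationSubring_superset] at hx
  have hx' : IsIntegral (Subring.closure (Set.range (algebraMap k K))) x := hx
  have hr : Subring.closure (Set.range (algebraMap k K)) = (algebraMap k K).range := by
    rw [← RingHom.coe_range, Subring.closure_eq]
  rw [hr] at hx'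
  have hint : IsIntegral k x := by
    obtain ⟨P, hP, hPx⟩ := hx'
    obtain ⟨Q, hQ, -, hQm⟩ := Polynomial.lifts_and_natDegree_eq_and_monic
      (Polynomial.map_surjective _ (algebraMap k K).rangeRestrict_surjective P) hP
    refine ⟨Q, hQm, ?_⟩
    rw [← hQ, Polynomial.eval₂_map] at hPx
    exact hPx
  obtain ⟨c, hc⟩ := (IsAlgClosed.algebraMap_bijective_of_isIntegral (k := k)).2
    (⟨x, hint⟩ : integralClosure k K)
  exact ⟨c, congrArg Subtype.val hc⟩

lemma valuation_algebraMap_eq_one {k K : Type*} [Field k] [Field K] [Algebra k K]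
    (B : ValuationSubring K) (hB : ∀ c : k, algebraMap k K c ∈ B) {c : k} (hc : c ≠ 0) :
    B.valuation (algebraMap k K c) = 1 := by
  refine le_antisymm ((B.valuation_le_one_iff _).2 (hB c)) ?_
  have h := (B.valuation_le_one_iff _).2 (hB c⁻¹)
  have hc' : algebraMap k K c ≠ 0 := by simpa using hc
  rw [map_inv₀, map_inv₀] at h
  exact (inv_le_one₀ (zero_lt_iff.2 ((B.valuation.ne_zero_iff).2 hc'))).1 h

/-! ### Squared distances in the function field. -/

section FunctionField

variable {V : Type u}

/-- The element of `ℂ(C)` given by a polynomial. -/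
noncomputable def toFunctionField (C : Set (V × Fin 2 → ℂ)) :
    MvPolynomial (V × Fin 2) ℂ →+* FunctionField C :=
  (algebraMap (CoordRing C) (FunctionField C)).comp (Ideal.Quotient.mk (vanishingIdeal ℂ C))

/-- The function `x_v + i y_v`. -/
noncomputable def wCoord (C : Set (V × Fin 2 → ℂ)) (v : V) : FunctionField C :=
  toFunctionField C (X (v, 0) + MvPolynomial.C Complex.I * X (v, 1))

/-- The function `x_v - i y_v`. -/
noncomputable def zCoord (C : Set (V × Fin 2 → ℂ)) (v : V) : FunctionField C :=
  toFunctionField C (X (v, 0) - MvPolynomial.C Complex.I * X (v, 1))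

/-- The squared distance of two vertices, as a polynomial. -/
noncomputable def sqDistPoly (u v : V) : MvPolynomial (V × Fin 2) ℂ :=
  (X (u, 0) - X (v, 0)) ^ 2 + (X (u, 1) - X (v, 1)) ^ 2

variable (C : Set (V × Fin 2 → ℂ))

lemma aeval_sqDistPoly (q : V × Fin 2 → ℂ) (u v : V) :
    aeval q (sqDistPoly u v) = sqDist q u v := by
  simp [sqDistPoly, sqDist]

lemma Wfun_eq (u v : V) : Wfun C u v = wCoord C u - wCoord C v := by
  rw [wCoord, wCoord, ← map_sub]
  change toFunctionField C _ = _
  congr 1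
  ring

lemma wCoord_sub_mul_zCoord_sub (u v : V) :
    (wCoord C u - wCoord C v) * (zCoord C u - zCoord C v) =
      toFunctionField C (sqDistPoly u v) := by
  have hI : (MvPolynomial.C Complex.I : MvPolynomial (V × Fin 2) ℂ) ^ 2 = -1 := by
    rw [← map_pow, Complex.I_sq, map_neg, map_one]
  rw [wCoord, wCoord, zCoord, zCoord, ← map_sub, ← map_sub, ← map_mul, sqDistPoly]
  congr 1
  linear_combination (-(X (u, 1) - X (v, 1)) ^ 2 : MvPolynomial (V × Fin 2) ℂ) * hI

lemma toFunctionField_C (c : ℂ) :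
    toFunctionField C (MvPolynomial.C c) = algebraMap ℂ (FunctionField C) c := by
  rw [IsScalarTower.algebraMap_apply ℂ (CoordRing C) (FunctionField C)]
  rfl

lemma toFunctionField_eq_iff (f g : MvPolynomial (V × Fin 2) ℂ) :
    toFunctionField C f = toFunctionField C g ↔ ∀ q ∈ C, aeval q f = aeval q g := by
  rw [toFunctionField, RingHom.comp_apply, RingHom.comp_apply,
    (IsFractionRing.injective (CoordRing C) (FunctionField C)).eq_iff, Ideal.Quotient.eq,
    mem_vanishingIdeal_iff]
  simp only [map_sub, sub_eq_zero]

/-- If all edge lengths are constant and nonzero on `C`, then the distance of the ends of a walk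
that is monochromatic for every active NAC-colouring is constant on `C`. -/
lemma exists_sqDist_eq_of_monochromatic (hirr : (vanishingIdeal ℂ C).IsPrime)
    {G : SimpleGraph V} (l : V → V → ℂ) (hl : ∀ a b, G.Adj a b → l a b ≠ 0)
    (hlen : ∀ a b, G.Adj a b → ∀ q ∈ C, sqDist q a b = l a b) {u v : V} (P : G.Walk u v)
    (hP : ∀ δ : G.edgeSet → Colour, IsActiveNAC G C δ → IsMonochromatic δ P) :
    ∃ d : ℂ, ∀ q ∈ C, sqDist q u v = d := by
  classical
  obtain ⟨d, hd⟩ := mem_range_algebraMap_of_forall_valuationSubring (k := ℂ)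
    (toFunctionField C (sqDistPoly u v)) fun B hB => by
      have hone : ∀ c : ℂ, c ≠ 0 → B.valuation (algebraMap ℂ (FunctionField C) c) = 1 :=
        fun c hc => valuation_algebraMap_eq_one B hB hc
      have hwz : ∀ a b, G.Adj a b → B.valuation (wCoord C a - wCoord C b) *
          B.valuation (zCoord C a - zCoord C b) = 1 := by
        intro a b hab
        rw [← map_mul, wCoord_sub_mul_zCoord_sub,
          (toFunctionField_eq_iff C _ (MvPolynomial.C (l a b))).2, toFunctionField_C]
        · exact hone _ (hl a b hab)
        · intro q hq
          rw [aeval_sqDistPoly, hlen a b hab q hq]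
          simp
      have hle : ∀ d₁ ∈ P.darts, ∀ d₂ ∈ P.darts,
          B.valuation (wCoord C d₂.fst - wCoord C d₂.snd) ≤
            B.valuation (wCoord C d₁.fst - wCoord C d₁.snd) := by
        intro d₁ h₁ d₂ h₂
        by_contra! hlt
        -- With the larger value, that of `d₂`, as strict threshold, `d₁` is red and `d₂` blue.
        let δ : G.edgeSet → Colour := fun e =>
          if ∃ a b, (e : Sym2 V) = s(a, b) ∧ B.valuation (wCoord C a - wCoord C b) <
            B.valuation (wCoord C d₂.fst - wCoord C d₂.snd) then Colour.red else Colour.blue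
        have hδ : ∀ (a b : V) (h : G.Adj a b),
            δ ⟨s(a, b), G.mem_edgeSet.mpr h⟩ = Colour.red ↔
              B.valuation (wCoord C a - wCoord C b) <
                B.valuation (wCoord C d₂.fst - wCoord C d₂.snd) := by
          intro a b h
          have : δ ⟨s(a, b), G.mem_edgeSet.mpr h⟩ = Colour.red ↔ ∃ a' b', s(a, b) = s(a', b') ∧
              B.valuation (wCoord C a' - wCoord C b') <
                B.valuation (wCoord C d₂.fst - wCoord C d₂.snd) := by
            refine ⟨fun hc => ?_, fun hc => if_pos hc⟩
            by_contra hcon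
            exact Colour.noConfusion ((if_neg hcon).symm.trans hc)
          rw [this]
          constructor
          · rintro ⟨a', b', he, hv⟩
            rcases Sym2.eq_iff.1 he with ⟨rfl, rfl⟩ | ⟨rfl, rfl⟩
            · exact hv
            · rwa [B.valuation.map_sub_swap]
          · exact fun hv => ⟨a, b, rfl, hv⟩
        have hr : δ ⟨d₁.edge, d₁.edge_mem⟩ = Colour.red := (hδ _ _ d₁.adj).2 hlt
        have hb : δ ⟨d₂.edge, d₂.edge_mem⟩ ≠ Colour.red := fun h =>
          lt_irrefl _ ((hδ _ _ d₂.adj).1 h)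
        have hs : Function.Surjective δ := by
          intro k
          cases k with
          | red => exact ⟨_, hr⟩
          | blue =>
            refine ⟨⟨d₂.edge, d₂.edge_mem⟩, ?_⟩
            revert hb
            cases δ ⟨d₂.edge, d₂.edge_mem⟩ <;> simp
        have hact : IsActiveNAC G C δ :=
          ⟨isNAC_of_valuation B.valuation _ _ hwz _ δ hs hδ, B.ValueGroup, inferInstance,
            B.valuation, _, hone, fun a b h => by rw [Wfun_eq]; exact hδ a b h⟩
        exact hb ((hP δ hact ⟨d₂.edge, d₂.edge_mem⟩ ⟨d₁.edge, d₁.edge_mem⟩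
          (List.mem_map_of_mem h₂) (List.mem_map_of_mem h₁)).trans hr)
      rw [← B.valuation_le_one_iff, ← wCoord_sub_mul_zCoord_sub, map_mul]
      -- An empty walk has zero difference; otherwise any dart `d₀` supplies the common value t.
      rcases P.darts.eq_nil_or_concat with hnil | ⟨_, d₀, hd₀⟩
      · have h0 := sum_darts_sub (wCoord C) P
        rw [hnil, List.map_nil, List.sum_nil] at h0
        rw [← h0, map_zero, zero_mul]
        exact zero_le
      · replace hd₀ : d₀ ∈ P.darts := by simp [hd₀]
        rw [← hwz _ _ d₀.adj]
        refine mul_le_mul' (valuation_sub_le_of_walk B.valuation _ P _ fun d hd => hle _ hd₀ _ hd)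
          (valuation_sub_le_of_walk B.valuation _ P _ fun d hd => ?_)
        rw [eq_inv_of_mul_eq_one_right (hwz _ _ d.adj),
          eq_inv_of_mul_eq_one_right (hwz _ _ d₀.adj)]
        exact inv_anti₀ (zero_lt_iff.2 (left_ne_zero_of_mul_eq_one (hwz _ _ d₀.adj)))
          (hle _ hd _ hd₀)
  refine ⟨d, fun q hq => ?_⟩
  rw [← toFunctionField_C, toFunctionField_eq_iff] at hd
  rw [← aeval_sqDistPoly, ← hd q hq]
  simp

end FunctionField

/-! ### Rotational symmetry and the added orbit of edges. -/

section Symmetry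

variable {V : Type u} {n : ℕ} {θ : Cyc n →* Equiv.Perm V} {G : SimpleGraph V}
  {p : V → EuclideanSpace ℝ (Fin 2)} {v₀ : V}

lemma exists_omega_pow_eq (hn : n ≠ 0) (γ : Cyc n) : ∃ k : ℕ, γ = omega n ^ k := by
  have : NeZero n := ⟨hn⟩
  refine ⟨(Multiplicative.toAdd γ).val, ?_⟩
  rw [omega, ← ofAdd_nsmul]
  simp

lemma sqDist_omega {q : V × Fin 2 → ℂ} (hq : q ∈ configSet n θ G p v₀) (a b : V) :
    sqDist q (θ (omega n) a) (θ (omega n) b) = sqDist q a b := by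
  obtain ⟨-, h0, h1, -⟩ := hq
  have hcs : (Real.cos (2 * Real.pi / n) : ℂ) ^ 2 + (Real.sin (2 * Real.pi / n) : ℂ) ^ 2 = 1 := by
    exact_mod_cast Real.cos_sq_add_sin_sq (2 * Real.pi / n)
  rw [sqDist, sqDist, h0, h0, h1, h1]
  linear_combination ((q (a, 0) - q (b, 0)) ^ 2 + (q (a, 1) - q (b, 1)) ^ 2) * hcs

lemma sqDist_act (hn : n ≠ 0) {q : V × Fin 2 → ℂ} (hq : q ∈ configSet n θ G p v₀) (γ : Cyc n)
    (a b : V) : sqDist q (θ γ a) (θ γ b) = sqDist q a b := by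
  obtain ⟨k, rfl⟩ := exists_omega_pow_eq hn γ
  induction k with
  | zero => simp
  | succ k ih => rw [pow_succ', map_mul, Equiv.Perm.mul_apply, Equiv.Perm.mul_apply,
      sqDist_omega hq, ih]

lemma sqDist_complexify (a b : V) :
    sqDist (complexify p) a b = ((‖p a - p b‖ ^ 2 : ℝ) : ℂ) := by
  rw [EuclideanSpace.norm_sq_eq]
  simp [sqDist, complexify, Fin.sum_univ_two]

/-- Points of `𝒱_n(G, p)` place invariant vertices at the origin. -/
lemma point_eq_zero_of_invariant (hn : 2 ≤ n) {q : V × Fin 2 → ℂ}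
    (hq : q ∈ configSet n θ G p v₀) {a : V} (ha : ∀ γ : Cyc n, θ γ a = a) : point q a = 0 := by
  obtain ⟨-, h0, h1, -⟩ := hq
  have e0 := h0 a
  have e1 := h1 a
  rw [ha] at e0 e1
  set c : ℝ := Real.cos (2 * Real.pi / n) with hc
  set s : ℝ := Real.sin (2 * Real.pi / n) with hs
  have hn' : (2 : ℝ) ≤ n := by exact_mod_cast hn
  have hc1 : c ≠ 1 := by
    intro h
    have hlt : 2 * Real.pi / n < 2 * Real.pi := by
      apply div_lt_self (by positivity); linarith
    have hpos : 0 < 2 * Real.pi / n := by have := Real.pi_pos; positivity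
    have := (Real.cos_eq_one_iff_of_lt_of_lt (by linarith) hlt).1 h
    exact hpos.ne' this
  have hcs : (c : ℂ) ^ 2 + (s : ℂ) ^ 2 = 1 := by
    exact_mod_cast Real.cos_sq_add_sin_sq (2 * Real.pi / n)
  -- This is the determinant of τ(ω) - 1, so the rotation fixes only the origin.
  have hdet : (2 * (1 - c) : ℂ) ≠ 0 := by
    refine mul_ne_zero two_ne_zero (sub_ne_zero.2 ?_)
    exact_mod_cast hc1.symm
  have hx : q (a, 0) = 0 := by
    refine (mul_eq_zero.1 ?_).resolve_left hdet
    linear_combination (1 - (c : ℂ)) * e0 + (s : ℂ) * e1 - q (a, 0) * hcs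
  have hy : q (a, 1) = 0 := by
    refine (mul_eq_zero.1 ?_).resolve_left hdet
    linear_combination (1 - (c : ℂ)) * e1 - (s : ℂ) * e0 - q (a, 1) * hcs
  simp [point, hx, hy]

lemma addOrbit_adj_iff {a b u v : V} : (addOrbit n θ G u v).Adj a b ↔
    G.Adj a b ∨ ((∃ γ : Cyc n, s(a, b) = s(θ γ u, θ γ v)) ∧ a ≠ b) := by
  simp [addOrbit]

lemma act_comm (γ γ' : Cyc n) (a : V) : θ γ (θ γ' a) = θ γ' (θ γ a) := by
  rw [← Equiv.Perm.mul_apply, ← Equiv.Perm.mul_apply, ← map_mul, ← map_mul, mul_comm]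

lemma orbit_edge_act {a b u v : V} (γ : Cyc n)
    (h : ∃ γ' : Cyc n, s(a, b) = s(θ γ' u, θ γ' v)) :
    ∃ γ' : Cyc n, s(θ γ a, θ γ b) = s(θ γ' u, θ γ' v) := by
  obtain ⟨γ', h⟩ := h
  refine ⟨γ * γ', ?_⟩
  simpa using congrArg (Sym2.map (θ γ)) h

lemma act_inv_act (γ : Cyc n) (a : V) : θ γ⁻¹ (θ γ a) = a := by
  rw [← Equiv.Perm.mul_apply, ← map_mul, inv_mul_cancel, map_one, Equiv.Perm.one_apply]

lemma invariant_of_act {a : V} (γ : Cyc n) (h : ∀ γ' : Cyc n, θ γ' (θ γ a) = θ γ a)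
    (γ' : Cyc n) : θ γ' a = a :=
  (θ γ).injective ((act_comm γ γ' a).trans (h γ'))

lemma IsSymmetricGraph.addOrbit (hG : IsSymmetricGraph n θ G) {u v : V}
    (hinv : (∀ γ : Cyc n, θ γ u = u) → ¬ ∀ γ : Cyc n, θ γ v = v) :
    IsSymmetricGraph n θ (addOrbit n θ G u v) where
  injective := hG.injective
  adj_iff γ a b := by
    rw [addOrbit_adj_iff, addOrbit_adj_iff, hG.adj_iff, (θ γ).injective.ne_iff]
    have : (∃ γ' : Cyc n, s(θ γ a, θ γ b) = s(θ γ' u, θ γ' v)) ↔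
        ∃ γ' : Cyc n, s(a, b) = s(θ γ' u, θ γ' v) :=
      ⟨fun h => by simpa only [act_inv_act] using orbit_edge_act γ⁻¹ h, orbit_edge_act γ⟩
    rw [this]
  invariant_of_partially := hG.invariant_of_partially
  independent a b ha hb hab := by
    rcases addOrbit_adj_iff.1 hab with h | ⟨⟨γ, h⟩, -⟩
    · exact hG.independent a b ha hb h
    · rcases Sym2.eq_iff.1 h with ⟨rfl, rfl⟩ | ⟨rfl, rfl⟩
      · exact hinv (invariant_of_act γ ha) (invariant_of_act γ hb)
      · exact hinv (invariant_of_act γ hb) (invariant_of_act γ ha)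

lemma sqDist_comm (q : V × Fin 2 → ℂ) (a b : V) : sqDist q a b = sqDist q b a := by
  rw [sqDist, sqDist]
  ring

/-- Invariant vertices sit at the origin, so u and v, being separated at p, are not both invariant:
the new edges keep invariant vertices independent. -/
lemma IsSymmetricMotion.addOrbit {C : Set (V × Fin 2 → ℂ)} (hn : 2 ≤ n)
    (hC : IsSymmetricMotion n θ G p v₀ C) (hp : complexify p ∈ C) {u v : V}
    (hne : point (complexify p) u ≠ point (complexify p) v)
    (hd : ∀ q ∈ C, sqDist q u v = sqDist (complexify p) u v) :
    IsSymmetricMotion n θ (addOrbit n θ G u v) p v₀ C := by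
  have hn0 : n ≠ 0 := by omega
  have hpne : p u ≠ p v := fun h => hne (by simp [point, complexify, h])
  have hdist : ∀ a b, (RotSym.addOrbit n θ G u v).Adj a b → ¬ G.Adj a b → ∀ q ∈ C,
      sqDist q a b = sqDist q u v := by
    intro a b hab hG q hq
    obtain ⟨⟨γ, h⟩, -⟩ := (addOrbit_adj_iff.1 hab).resolve_left hG
    rw [← sqDist_act hn0 (hC.subset hq) γ u v]
    rcases Sym2.eq_iff.1 h with ⟨rfl, rfl⟩ | ⟨rfl, rfl⟩
    · rfl
    · exact sqDist_comm ..
  refine ⟨⟨hC.framework.graph.addOrbit fun hu hv => ?_, fun a b hab heq => ?_,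
    hC.framework.symmetric⟩, hC.base_not_invariant, hC.base_ne_zero, hC.base_on_axis, hC.curve,
    fun q hq => ?_⟩
  · exact hne ((point_eq_zero_of_invariant hn (hC.subset hp) hu).trans
      (point_eq_zero_of_invariant hn (hC.subset hp) hv).symm)
  · by_cases hG : G.Adj a b
    · exact hC.framework.placement a b hG heq
    · have h := hdist a b hab hG _ hp
      rw [sqDist_complexify, sqDist_complexify, heq, Complex.ofReal_inj, sub_self] at h
      -- Since p is real, distinct points have nonzero squared distance, which can fail over ℂ.
      exact pow_ne_zero 2 (norm_ne_zero_iff.2 (sub_ne_zero.2 hpne)) (by simpa using h.symm)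
  · obtain ⟨h1, h2, h3, h4⟩ := hC.subset hq
    refine ⟨h1, h2, h3, fun a b hab => ?_⟩
    by_cases hG : G.Adj a b
    · exact h4 a b hG
    · rw [hdist a b hab hG q hq, hd q hq, ← hdist a b hab hG _ hp, sqDist_complexify]

end Symmetry

end RotSym

theorem lemma4p1 {V : Type*} [Finite V] (n : ℕ) (hn : 2 ≤ n)
    (θ : RotSym.Cyc n →* Equiv.Perm V) (G : SimpleGraph V)
    (p : V → EuclideanSpace ℝ (Fin 2)) (v₀ : V) (C : Set (V × Fin 2 → ℂ))
    (hC : RotSym.IsSymmetricMotion n θ G p v₀ C)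
    (u v : V) (huv : ¬ G.Adj u v)
    (hne : ∀ q ∈ C, RotSym.point q u ≠ RotSym.point q v)
    (hP : ∃ P : G.Walk u v, P.IsPath ∧
      ∀ δ : G.edgeSet → RotSym.Colour, RotSym.IsActiveNAC G C δ → RotSym.IsMonochromatic δ P) :
    (∃ d : ℂ, ∀ q ∈ C, RotSym.sqDist q u v = d) ∧
    (RotSym.complexify p ∈ C →
      RotSym.IsSymmetricMotion n θ (RotSym.addOrbit n θ G u v) p v₀ C) := by
  obtain ⟨P, -, hmono⟩ := hP
  obtain ⟨d, hd⟩ := RotSym.exists_sqDist_eq_of_monochromatic C hC.curve.irreducible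
    (fun a b => ((‖p a - p b‖ ^ 2 : ℝ) : ℂ))
    (fun a b hab => by simpa [sub_eq_zero] using hC.framework.placement a b hab)
    (fun a b hab q hq => (hC.subset hq).2.2.2 a b hab) P hmono
  exact ⟨⟨d, hd⟩, fun hp =>
    hC.addOrbit hn hp (hne _ hp) fun q hq => (hd q hq).trans (hd _ hp).symm⟩
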